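/- All actions on metric spaces are isometric, and a hyperbolic space is a geodesic metric space that is hyperbolic in the sense of Gromov. An action of a group $G$ on a hyperbolic space $S$ is acylindrical if for every $\varepsilon>0$ there are $R,N>0$ such that for all $x,y\in S$ with $d(x,y)\ge R$ at most $N$ elements $g\in G$ satisfy both $d(x,gx)\le\varepsilon$ and $d(y,gy)\le\varepsilon$; it is non-elementary if its limit set in the Gromov boundary $\partial S$ has more than two points. A group is acylindrically hyperbolic if it admits a non-elementary acylindrical action on a hyperbolic space. For (possibly infinite) generating sets $X,Y$ of a group $G$ write $X\preceq Y$ if the identity map $(G,d_Y)\to(G,d_X)$ between the word metrics is Lipschitz. Write $[X]$ for the class of $X$ under the equivalence relation ($X\preceq Y$ and $Y\preceq X$), and order the classes by $[X]\preccurlyeq[Y]\iff X\preceq Y$. Let $\mathcal{AH}(G)$ be the poset of the classes $[X]$ such that the Cayley graph $\Gamma(G,X)$ is hyperbolic and the action of $G$ on $\Gamma(G,X)$ is acylindrical. The group $G$ is $\mathcal{AH}$-accessible if $\mathcal{AH}(G)$ has a largest element. **Proposition.** Let $G$ be a group and let $H$ be a normal subgroup of finite index in $G$ that is acylindrically hyperbolic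 and $\mathcal{AH}$-accessible. Then $G$ is $\mathcal{AH}$-accessible. Moreover, if $X$ is any generating set of $H$ such that $[X]$ is the largest element of $\mathcal{AH}(H)$, and $Y\subseteq G$ is any set containing exactly one representative of each coset of $H$ in $G$, then $X\cup Y$ generates $G$ and $[X\cup Y]$ is the largest element of $\mathcal{AH}(G)$. -/

import Mathlib

open Filter
open scoped NNReal

universe u v

namespace AHStruct

/-! ### Hyperbolic spaces, Gromov boundary, limit sets -/

/-- The Gromov product `(x | y)_o`. -/
noncomputable def gromovProduct {S : Type u} [MetricSpace S] (o x y : S) : ℝ :=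
  (dist x o + dist y o - dist x y) / 2

/-- A metric space is hyperbolic in the sense of Gromov if, for some constant `δ`,
`(x | z)_o ≥ min ((x | y)_o, (y | z)_o) - δ` for all points `x`, `y`, `z`, `o`. -/
def IsGromovHyperbolic (S : Type u) [MetricSpace S] : Prop :=
  ∃ δ : ℝ, ∀ x y z o : S,
    min (gromovProduct o x y) (gromovProduct o y z) - δ ≤ gromovProduct o x z

/-- Every two points are joined by a geodesic segment. -/
def IsGeodesicSpace (S : Type u) [MetricSpace S] : Prop :=
  ∀ x y : S, ∃ γ : ℝ → S, γ 0 = x ∧ γ (dist x y) = y ∧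
    ∀ s ∈ Set.Icc 0 (dist x y), ∀ t ∈ Set.Icc 0 (dist x y), dist (γ s) (γ t) = |s - t|

/-- The sequence `x` converges at infinity: `(x i | x j)_o → ∞` as `i, j → ∞`. -/
def ConvergesAtInfinity {S : Type u} [MetricSpace S] (x : ℕ → S) : Prop :=
  ∀ o : S, Tendsto (fun p : ℕ × ℕ => gromovProduct o (x p.1) (x p.2)) atTop atTop

/-- Two sequences converging at infinity are equivalent if `(x i | y j)_o → ∞`
as `i, j → ∞`. On a hyperbolic space this is an equivalence relation. -/
def SameEnd {S : Type u} [MetricSpace S]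
    (x y : {x : ℕ → S // ConvergesAtInfinity x}) : Prop :=
  ∀ o : S, Tendsto (fun p : ℕ × ℕ => gromovProduct o (x.1 p.1) (y.1 p.2)) atTop atTop

/-- The (sequential) Gromov boundary of a hyperbolic space. -/
def GromovBoundary (S : Type u) [MetricSpace S] : Type u :=
  Quot (SameEnd (S := S))

/-- The limit set of a group acting on a hyperbolic space: the boundary points represented by
sequences of points of an orbit. -/
def limitSet (G : Type u) [Group G] (S : Type v) [MetricSpace S] [MulAction G S] :
    Set (GromovBoundary S) :=
  {ξ | ∃ (s : S) (x : {x : ℕ → S // ConvergesAtInfinity x}),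
    (∀ n, x.1 n ∈ MulAction.orbit G s) ∧ Quot.mk _ x = ξ}

/-- An action on a hyperbolic space is non-elementary if its limit set has more than two
points. -/
def IsNonElementary (G : Type u) [Group G] (S : Type v) [MetricSpace S] [MulAction G S] : Prop :=
  2 < (limitSet G S).encard

/-- The action of `G` on `S` is acylindrical: for every `ε > 0` there are `R, N` such that for all
`x, y` at distance at least `R`, at most `N` elements of `G` move both `x` and `y` by at most
`ε`. -/
def IsAcylindrical (G : Type u) [Group G] (S : Type v) [MetricSpace S] [MulAction G S] : Prop :=
  ∀ ε : ℝ, 0 < ε → ∃ (R : ℝ) (N : ℕ), 0 < R ∧ ∀ x y : S, R ≤ dist x y →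
    {g : G | dist x (g • x) ≤ ε ∧ dist y (g • y) ≤ ε}.encard ≤ N

/-- A group is acylindrically hyperbolic if it admits a non-elementary, acylindrical, isometric
action on a hyperbolic (geodesic) space. -/
def IsAcylindricallyHyperbolic (G : Type u) [Group G] : Prop :=
  ∃ (S : Type v) (_ : MetricSpace S) (_ : MulAction G S),
    IsIsometricSMul G S ∧ IsGeodesicSpace S ∧ IsGromovHyperbolic S ∧
      IsAcylindrical G S ∧ IsNonElementary G S

/-! ### Generating sets and Cayley graphs -/

/-- A generating set of `G`, possibly infinite. -/
structure GenSet (G : Type u) [Group G] where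
  /-- the underlying set -/
  carrier : Set G
  closure_eq_top : Subgroup.closure carrier = ⊤

theorem mulCayley_connected {G : Type u} [Group G] {X : Set G} (hX : Subgroup.closure X = ⊤) :
    (SimpleGraph.mulCayley X).Connected := by
  have step : ∀ x ∈ X, ∀ g : G, (SimpleGraph.mulCayley X).Reachable g (g * x) := by
    intro x hx g
    by_cases h : g = g * x
    · rw [← h]
    · exact SimpleGraph.Adj.reachable
        ((SimpleGraph.mulCayley_adj' X g (g * x)).2 ⟨h, x, hx, Or.inl rfl⟩)
  have key : ∀ h ∈ Subgroup.closure X, ∀ g : G,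
      (SimpleGraph.mulCayley X).Reachable g (g * h) := by
    intro h hh
    induction hh using Subgroup.closure_induction with
    | mem x hx => exact step x hx
    | one => intro g; rw [mul_one]
    | mul a b _ _ ha hb => intro g; rw [← mul_assoc]; exact (ha g).trans (hb (g * a))
    | inv a _ ha => intro g; simpa using (ha (g * a⁻¹)).symm
  have : Nonempty G := ⟨1⟩
  refine SimpleGraph.Connected.mk fun g h => ?_
  simpa using key (g⁻¹ * h) (by rw [hX]; trivial) g

/-- The vertex set of the Cayley graph `Γ(G, X)`, i.e. the group `G`, equipped below with the path
metric of the Cayley graph (the word metric `d_X`) and with the left translation action of `G`.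

It is an isometrically embedded, `G`-invariant subset of the geometric realization of the graph
such that every point of the realization is within `1/2` of it. Hence `Γ(G, X)` (which is always
geodesic) is hyperbolic if and only if this metric space satisfies Gromov's condition, and the
action of `G` on `Γ(G, X)` is acylindrical if and only if the action on this metric space is. -/
@[ext]
structure Cayley {G : Type u} [Group G] (X : GenSet G) : Type u where
  /-- the element of the group -/
  elem : G

noncomputable instance {G : Type u} [Group G] (X : GenSet G) : MetricSpace (Cayley X) where
  dist g h := ((SimpleGraph.mulCayley X.carrier).dist g.elem h.elem : ℝ)
  dist_self g := by simp
  dist_comm g h := by rw [SimpleGraph.dist_comm]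
  dist_triangle g h k := by
    exact_mod_cast (mulCayley_connected X.closure_eq_top).dist_triangle
  eq_of_dist_eq_zero {g h} hgh :=
    Cayley.ext ((mulCayley_connected X.closure_eq_top).dist_eq_zero_iff.1 (by exact_mod_cast hgh))

theorem Cayley.dist_def {G : Type u} [Group G] (X : GenSet G) (g h : Cayley X) :
    dist g h = ((SimpleGraph.mulCayley X.carrier).dist g.elem h.elem : ℝ) :=
  rfl

instance {G : Type u} [Group G] (X : GenSet G) : MulAction G (Cayley X) where
  smul g x := ⟨g * x.elem⟩
  one_smul x := Cayley.ext (one_mul x.elem)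
  mul_smul g h x := Cayley.ext (mul_assoc g h x.elem)

theorem Cayley.smul_def {G : Type u} [Group G] (X : GenSet G) (g : G) (x : Cayley X) :
    g • x = ⟨g * x.elem⟩ :=
  rfl

/-- `X ≤ Y` means that `X` is dominated by `Y`: the identity map of `G` is Lipschitz as a map
`(G, d_Y) → (G, d_X)`. -/
instance {G : Type u} [Group G] : Preorder (GenSet G) where
  le X Y := ∃ C : ℝ≥0, LipschitzWith C (fun g : Cayley Y => (⟨g.elem⟩ : Cayley X))
  le_refl X := ⟨1, fun g h => by simp⟩
  le_trans X Y Z := by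
    rintro ⟨C, hC⟩ ⟨D, hD⟩
    refine ⟨C * D, fun g h => ?_⟩
    calc _ ≤ C * edist (⟨g.elem⟩ : Cayley Y) ⟨h.elem⟩ := hC ⟨g.elem⟩ ⟨h.elem⟩
      _ ≤ C * (D * edist g h) := by gcongr; exact hD g h
      _ = _ := by rw [ENNReal.coe_mul, mul_assoc]

/-! ### Acylindrically hyperbolic structures -/

/-- The partially ordered set of equivalence classes of generating sets of `G`; here
`X` and `Y` are equivalent if each dominates the other. -/
abbrev GenClass (G : Type u) [Group G] : Type u :=
  Antisymmetrization (GenSet G) (· ≤ ·)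

/-- The equivalence class `[X]` of a generating set `X`. -/
def GenSet.toClass {G : Type u} [Group G] (X : GenSet G) : GenClass G :=
  toAntisymmetrization (· ≤ ·) X

/-- The set of acylindrically hyperbolic structures on `G`: the classes `[X]` of generating sets
such that the Cayley graph `Γ(G, X)` is hyperbolic and the action of `G` on it is acylindrical. -/
def AH (G : Type u) [Group G] : Set (GenClass G) :=
  {a | ∃ X : GenSet G, IsGromovHyperbolic (Cayley X) ∧ IsAcylindrical G (Cayley X) ∧
    X.toClass = a}

/-- `G` is AH-accessible: the poset `AH G` has a largest element. -/
def IsAHAccessible (G : Type u) [Group G] : Prop :=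
  ∃ a : GenClass G, IsGreatest (AH G) a

end AHStruct

/-! Being largest makes `[X]` invariant under every automorphism of `H`: the image of `X` is again a
structure in `AH H`, hence dominated by `X`. So conjugation by a fixed element of `G` sends `X` to a
set of bounded `X`-length (`exists_wordLength_conj_le`). Since `Y` is finite, the retraction `h * y
↦ h` is then Lipschitz from the word metric of `X ∪ Y` to that of `X`, and in fact a quasi-isometric
embedding (`exists_isQIEmbeddingWith_retract`). It is `H`-equivariant, so it pulls back
hyperbolicity and acylindricity of `H`; finite index upgrades the latter to `G`.

For maximality, any `W` in `AH G` restricts to `H`: the elements of `H` of bounded `W`-length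
generate `H`, with word metric quasi-isometric to the restriction of `d_W`
(`exists_mem_AH_restrict`). That structure is dominated by `X`, so `X` has bounded `W`-length, and
so has the finite set `Y`.

The analytic input is that hyperbolicity pulls back along quasi-isometric embeddings. It is proved
on vertex sets, with integer geodesics, through stability of quasi-geodesics and slim triangles. -/

namespace AHStruct

/-! ### Hyperbolicity is inherited along quasi-isometric embeddings -/

section Coarse

variable {S : Type u} [MetricSpace S] {T : Type v} [MetricSpace T]

/-- Every two points are joined by a geodesic with integer parameter. -/
def HasDiscreteGeodesics (S : Type u) [MetricSpace S] : Prop :=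
  ∀ x y : S, ∃ (n : ℕ) (p : ℕ → S), p 0 = x ∧ p n = y ∧
    ∀ i j : ℕ, i ≤ j → j ≤ n → dist (p i) (p j) = j - i

/-- The map `f` distorts distances by at most a linear function with coefficients `L`. -/
def IsQIEmbeddingWith (L : ℝ) (f : S → T) : Prop :=
  ∀ x y : S, dist (f x) (f y) ≤ L * dist x y + L ∧ dist x y ≤ L * dist (f x) (f y) + L

/-- The first `n + 1` points of the sequence `b` form a quasi-geodesic with constants `L`. -/
def IsQuasiGeodesic (L : ℝ) (n : ℕ) (b : ℕ → S) : Prop :=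
  ∀ i j : ℕ, i ≤ j → j ≤ n →
    dist (b i) (b j) ≤ L * ((j : ℝ) - i) + L ∧ (j : ℝ) - i ≤ L * dist (b i) (b j) + L

/-! ### Elementary inequalities for Gromov products. -/

theorem gromovProduct_comm (o x y : S) : gromovProduct o x y = gromovProduct o y x := by
  unfold gromovProduct
  rw [dist_comm x y]
  ring

theorem gromovProduct_self (o x : S) : gromovProduct o x x = dist x o := by
  unfold gromovProduct
  rw [dist_self]
  ring

theorem dist_sub_dist_le_gromovProduct (o x y : S) :
    dist o x - dist x y ≤ gromovProduct o x y := by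
  unfold gromovProduct
  have := dist_triangle_right o x y
  rw [dist_comm x o, dist_comm y o]
  linarith

theorem gromovProduct_le_add_dist (o x y z : S) :
    gromovProduct o x y ≤ gromovProduct o x z + dist y z := by
  unfold gromovProduct
  have h1 := dist_triangle y z o
  have h2 := dist_triangle x y z
  linarith

/-- A point is at least as far from a point of a geodesic as the Gromov product of the ends. -/
theorem gromovProduct_le_dist_of_dist_add_le {x y p : S} (o : S)
    (h : dist x p + dist p y ≤ dist x y) : gromovProduct o x y ≤ dist o p := by
  unfold gromovProduct
  have h1 := dist_triangle x p o
  have h2 := dist_triangle y p o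
  rw [dist_comm p o] at h1 h2
  rw [dist_comm p y] at h
  linarith

/-- The inequality of the definition of a hyperbolic space, with an explicit constant. -/
def HyperbolicWith (δ : ℝ) (S : Type u) [MetricSpace S] : Prop :=
  ∀ x y z o : S, min (gromovProduct o x y) (gromovProduct o y z) - δ ≤ gromovProduct o x z

theorem HyperbolicWith.nonneg {δ : ℝ} (hS : HyperbolicWith δ S) (o : S) : 0 ≤ δ := by
  have := hS o o o o
  simp only [gromovProduct_self, dist_self, min_self] at this
  linarith

/-! ### Stability of quasi-geodesics. -/

/-- Paths avoiding a ball have endpoints with a large Gromov product, up to a logarithm of the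
length of the path. -/
theorem HyperbolicWith.le_gromovProduct_of_path {δ : ℝ} (hS : HyperbolicWith δ S) (b : ℕ → S)
    (p : S) {D c : ℝ} (hc : 0 ≤ c) (k : ℕ) :
    ∀ i j : ℕ, i ≤ j → j - i ≤ 2 ^ k → (∀ l, i ≤ l → l < j → dist (b l) (b (l + 1)) ≤ c) →
      (∀ l, i ≤ l → l ≤ j → D ≤ dist p (b l)) → D - c - k * δ ≤ gromovProduct p (b i) (b j) := by
  induction k with
  | zero =>
    intro i j hij hk hb hD
    have h1 := dist_sub_dist_le_gromovProduct p (b i) (b j)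
    have h2 := hD i le_rfl hij
    obtain rfl | rfl : j = i ∨ j = i + 1 := by simp at hk; omega
    · rw [dist_self] at h1
      simp only [Nat.cast_zero]
      linarith
    · have := hb i le_rfl (by omega)
      simp only [Nat.cast_zero]
      linarith
  | succ k ih =>
    intro i j hij hk hb hD
    -- Bisecting the index interval costs one `δ` per halving, so `k` halvings cost `k * δ`.
    rw [pow_succ] at hk
    have h1 := ih i ((i + j) / 2) (by omega) (by omega) (fun l h h' => hb l h (by omega))
      (fun l h h' => hD l h (by omega))
    have h2 := ih ((i + j) / 2) j (by omega) (by omega) (fun l h h' => hb l (by omega) h')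
      (fun l h h' => hD l (by omega) h')
    have h3 := hS (b i) (b ((i + j) / 2)) (b j) p
    have h4 := le_min h1 h2
    push_cast
    linarith

theorem exists_linear_le_two_pow (a c : ℝ) : ∃ k₀ : ℕ, ∀ k ≥ k₀, a * k + c ≤ (2 : ℝ) ^ k := by
  have h1 : Tendsto (fun k : ℕ => (k : ℝ) ^ 1 / 2 ^ k) atTop (nhds 0) :=
    tendsto_pow_const_div_const_pow_of_one_lt 1 one_lt_two
  have h0 : Tendsto (fun k : ℕ => (k : ℝ) ^ 0 / 2 ^ k) atTop (nhds 0) :=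
    tendsto_pow_const_div_const_pow_of_one_lt 0 one_lt_two
  have h := (h1.const_mul a).add (h0.const_mul c)
  simp only [mul_zero, add_zero] at h
  obtain ⟨k₀, hk⟩ := eventually_atTop.1 (h.eventually (gt_mem_nhds one_pos))
  refine ⟨k₀, fun k hk' => ?_⟩
  have h2 := hk k hk'
  have h3 : (0 : ℝ) < 2 ^ k := by positivity
  have h4 : (a * k + c) / 2 ^ k < 1 := by
    calc (a * k + c) / 2 ^ k = a * ((k : ℝ) ^ 1 / 2 ^ k) + c * ((k : ℝ) ^ 0 / 2 ^ k) := by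
          simp only [pow_one, pow_zero]; ring
      _ < 1 := h2
  rw [div_lt_one h3] at h4
  exact h4.le

/-- Exponential beats linear: with `k` about `D / (δ + 1)`, the cost `k * δ` stays below `D`, while
`2 ^ k` exceeds the index length of a quasi-geodesic whose ends are at distance at most `6 * D + 2`.
Dividing by `δ + 1` covers `δ = 0`. -/
theorem exists_pow_bound {δ L : ℝ} (hδ : 0 ≤ δ) (hL : 0 ≤ L) :
    ∃ D₀ : ℝ, ∀ D > D₀, ∃ k : ℕ, L * (6 * D + 2) + L ≤ 2 ^ k ∧ 2 * L + (k + 2) * δ < D := by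
  -- The coefficients come from putting `D < (k + 3) * (δ + 1) + 2 * L + 1` into `L * (6 * D + 2) +
  -- L`.
  obtain ⟨k₀, hk₀⟩ := exists_linear_le_two_pow (6 * L * (δ + 1))
    (L * (6 * (3 * (δ + 1) + 2 * L + 1) + 2) + L)
  refine ⟨(k₀ + 3) * (δ + 1) + 2 * L + 1, fun D hD => ?_⟩
  have hδ' : 0 < δ + 1 := by linarith
  set q := ⌊(D - 2 * L - 1) / (δ + 1)⌋₊ with hq
  have hq1 : (q : ℝ) * (δ + 1) ≤ D - 2 * L - 1 := by
    rw [← le_div_iff₀ hδ']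
    refine Nat.floor_le (div_nonneg ?_ hδ'.le)
    have : 0 ≤ ((k₀ : ℝ) + 3) * (δ + 1) := by positivity
    linarith
  have hq2 : D - 2 * L - 1 < (q + 1) * (δ + 1) := by
    rw [← div_lt_iff₀ hδ']
    exact Nat.lt_floor_add_one _
  have hq3 : k₀ + 3 ≤ q := by
    refine Nat.le_floor ?_
    rw [le_div_iff₀ hδ']
    push_cast
    linarith
  clear_value q
  obtain ⟨k, rfl⟩ : ∃ k, q = k + 2 := ⟨q - 2, by omega⟩
  refine ⟨k, le_trans ?_ (hk₀ k (by omega)), ?_⟩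
  · push_cast at hq2
    have : L * D ≤ L * ((k + 2 + 1) * (δ + 1) + 2 * L + 1) :=
      mul_le_mul_of_nonneg_left (by linarith) hL
    nlinarith
  · push_cast at hq1
    have : (0 : ℝ) ≤ k + 2 := by positivity
    nlinarith

/-- Geodesics lie in uniform neighbourhoods of quasi-geodesics with the same ends. -/
theorem HyperbolicWith.exists_geodesic_near_quasiGeodesic {δ : ℝ} (hS : HyperbolicWith δ S)
    {L : ℝ} (hL : 0 ≤ L) : ∃ D₀ : ℝ, ∀ (n : ℕ) (b : ℕ → S), IsQuasiGeodesic L n b →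
      ∀ (m : ℕ) (γ : ℕ → S), γ 0 = b 0 → γ m = b n →
      (∀ i j : ℕ, i ≤ j → j ≤ m → dist (γ i) (γ j) = j - i) →
      ∀ t ≤ m, ∃ i ≤ n, dist (γ t) (b i) ≤ D₀ := by
  rcases isEmpty_or_nonempty S with hE | ⟨⟨o⟩⟩
  · exact ⟨0, fun n b => isEmptyElim (b 0)⟩
  obtain ⟨D₀, hD₀⟩ := exists_pow_bound (hS.nonneg o) hL
  refine ⟨D₀, fun n b hb m γ h0 hm hγ t ht => ?_⟩
  have hmin : ∀ t, ∃ i ∈ Finset.range (n + 1), ∀ j ∈ Finset.range (n + 1),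
      dist (γ t) (b i) ≤ dist (γ t) (b j) := fun t =>
    Finset.exists_min_image _ _ ⟨0, by simp⟩
  choose ι hι hιmin using hmin
  simp only [Finset.mem_range, Nat.lt_succ_iff] at hι hιmin
  -- `γ s` is a worst point of the geodesic: `b` avoids the open `D`-ball around it, yet every `γ t`
  -- is within `D` of `b`.
  obtain ⟨s, hs, hsmax⟩ := Finset.exists_max_image (Finset.range (m + 1))
    (fun t => dist (γ t) (b (ι t))) ⟨0, by simp⟩
  simp only [Finset.mem_range, Nat.lt_succ_iff] at hs hsmax
  set D := dist (γ s) (b (ι s)) with hD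
  refine ⟨ι t, hι t, (hsmax t ht).trans ?_⟩
  by_contra! hlt
  obtain ⟨k, hk1, hk2⟩ := hD₀ D hlt
  have hDnn : 0 ≤ D := dist_nonneg
  have hDle : ∀ j ≤ n, D ≤ dist (γ s) (b j) := hιmin s
  -- A point of `γ` at distance `e ≥ 2 * D` from `γ s` has a point of `b` within `D`, so their
  -- Gromov product at `γ s` is at least `D`. If `γ` ends sooner, its endpoint already lies on `b`.
  set e := ⌈2 * D⌉₊ with he
  have he1 : 2 * D ≤ e := Nat.le_ceil _
  have he2 : (e : ℝ) < 2 * D + 1 := Nat.ceil_lt_add_one (by linarith)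
  have near : ∀ r, r ≤ m → dist (γ s) (γ r) = e →
      D ≤ gromovProduct (γ s) (γ r) (b (ι r)) ∧ dist (γ s) (b (ι r)) ≤ 3 * D + 1 := by
    intro r hr her
    have h1 := dist_sub_dist_le_gromovProduct (γ s) (γ r) (b (ι r))
    have h2 := hsmax r hr
    have h3 := dist_triangle (γ s) (γ r) (b (ι r))
    constructor <;> linarith
  obtain ⟨y, i, hys, hi, hy1, hy2⟩ : ∃ y i, y ≤ s ∧ i ≤ n ∧
      D ≤ gromovProduct (γ s) (γ y) (b i) ∧ dist (γ s) (b i) ≤ 3 * D + 1 := by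
    rcases le_total e s with h | h
    · have := near (s - e) (by omega) (by
        rw [dist_comm, hγ (s - e) s (by omega) hs, Nat.cast_sub h]; ring)
      exact ⟨s - e, ι (s - e), by omega, hι _, this⟩
    · have h1 := hγ 0 s (by omega) hs
      have h2 : (s : ℝ) ≤ e := by exact_mod_cast h
      rw [h0, dist_comm] at h1
      refine ⟨0, 0, by omega, by omega, ?_, ?_⟩
      · rw [h0, gromovProduct_self, dist_comm]
        exact hDle 0 (by omega)
      · push_cast at h1
        linarith
  obtain ⟨z, j, hsz, hzm, hj, hz1, hz2⟩ : ∃ z j, s ≤ z ∧ z ≤ m ∧ j ≤ n ∧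
      D ≤ gromovProduct (γ s) (γ z) (b j) ∧ dist (γ s) (b j) ≤ 3 * D + 1 := by
    rcases le_total (s + e) m with h | h
    · have := near (s + e) h (by
        rw [hγ s (s + e) (by omega) h]; push_cast; ring)
      exact ⟨s + e, ι (s + e), by omega, h, hι _, this⟩
    · have h1 := hγ s m hs le_rfl
      have h2 : (m : ℝ) ≤ s + e := by exact_mod_cast h
      rw [hm] at h1
      refine ⟨m, n, hs, le_rfl, le_rfl, ?_, ?_⟩
      · rw [hm, gromovProduct_self, dist_comm]
        exact hDle n le_rfl
      · linarith
  -- Successive points of `b` are at most `2 * L` apart, and `6 * D + 2` is twice the radius `3 * D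
  -- + 1`.
  have hpath : ∀ i j, i ≤ j → j ≤ n → dist (γ s) (b i) ≤ 3 * D + 1 →
      dist (γ s) (b j) ≤ 3 * D + 1 → D - 2 * L - k * δ ≤ gromovProduct (γ s) (b i) (b j) := by
    intro i j hij hj hi' hj'
    refine hS.le_gromovProduct_of_path b (γ s) (by linarith) k i j hij ?_ ?_ ?_
    · have h1 := (hb i j hij hj).2
      have h2 : dist (b i) (b j) ≤ 6 * D + 2 := by
        have := dist_triangle_left (b i) (b j) (γ s)
        linarith
      have h3 : (j : ℝ) - i ≤ 2 ^ k := by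
        have := mul_le_mul_of_nonneg_left h2 hL
        linarith
      rw [← Nat.cast_sub hij] at h3
      exact_mod_cast h3
    · intro l hl hl'
      have := (hb l (l + 1) (by omega) (by omega)).1
      push_cast at this
      linarith
    · intro l hl hl'
      exact hDle l (by omega)
  have hbb : D - 2 * L - k * δ ≤ gromovProduct (γ s) (b i) (b j) := by
    rcases le_total i j with h | h
    · exact hpath i j h hj hy2 hz2
    · rw [gromovProduct_comm]
      exact hpath j i h hi hz2 hy2
  -- The contradiction: this product vanishes, as `γ s` lies between `γ y` and `γ z`, but the chain
  -- `γ y`, `b i`, `b j`, `γ z` bounds it below by `D - 2 * L - (k + 2) * δ > 0`.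
  have hzero : gromovProduct (γ s) (γ y) (γ z) = 0 := by
    unfold gromovProduct
    rw [hγ y s hys hs, dist_comm, hγ s z hsz hzm, hγ y z (by omega) hzm]
    ring
  have hδ := hS.nonneg o
  have hkδ : 0 ≤ k * δ := by positivity
  have h1 := hS (γ y) (b i) (b j) (γ s)
  have h2 := hS (γ y) (b j) (γ z) (γ s)
  rw [gromovProduct_comm _ (b j)] at h2
  have h3 : D - 2 * L - k * δ - δ ≤ gromovProduct (γ s) (γ y) (b j) := by
    have h3 : D - 2 * L - k * δ ≤ gromovProduct (γ s) (γ y) (b i) := by linarith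
    have := le_min h3 hbb
    linarith
  have h4 : D - 2 * L - k * δ - δ ≤ gromovProduct (γ s) (γ z) (b j) := by linarith
  have h5 := le_min h3 h4
  linarith

/-- Connectedness of an integer interval: two conditions covering it must meet, up to one step. The
possible step accounts for the slack of `1` or `2 * L` where this is applied. -/
theorem exists_switch {P Q : ℕ → Prop} {m : ℕ} (hPQ : ∀ t ≤ m, P t ∨ Q t) (h0 : P 0)
    (hm : Q m) : (∃ t ≤ m, P t ∧ Q t) ∨ ∃ t < m, P t ∧ Q (t + 1) := by
  by_contra! h
  have : ∀ t ≤ m, P t := by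
    intro t
    induction t with
    | zero => exact fun _ => h0
    | succ t ih =>
      intro ht
      exact (hPQ (t + 1) ht).resolve_right (h.2 t (by omega) (ih (by omega)))
  exact h.1 m le_rfl (this m le_rfl) hm

/-- Quasi-geodesics of a hyperbolic space are uniformly close to being geodesic. -/
theorem HyperbolicWith.exists_gromovProduct_quasiGeodesic_le {δ : ℝ} (hS : HyperbolicWith δ S)
    (hgeo : HasDiscreteGeodesics S) {L : ℝ} (hL : 0 ≤ L) :
    ∃ K : ℝ, ∀ (n : ℕ) (b : ℕ → S), IsQuasiGeodesic L n b →
      ∀ i ≤ n, gromovProduct (b i) (b 0) (b n) ≤ K := by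
  obtain ⟨D, hD⟩ := hS.exists_geodesic_near_quasiGeodesic hL
  refine ⟨L * (L * (2 * D + 1) + L) + L + D, fun n b hb i hi => ?_⟩
  obtain ⟨m, γ, h0, hm, hγ⟩ := hgeo (b 0) (b n)
  have hnear := hD n b hb m γ h0 hm hγ
  have hD0 : 0 ≤ D := by
    obtain ⟨j, -, hj⟩ := hnear 0 (Nat.zero_le _)
    exact dist_nonneg.trans hj
  -- If `γ` passes from near `b j` to near `b k` with `j ≤ i ≤ k`, then `k - j` is bounded, so `b i`
  -- is close to `b j` and hence to `γ s`.
  have key : ∀ s t, s ≤ m → t ≤ m → dist (γ s) (γ t) ≤ 1 →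
      (∃ j ≤ i, dist (γ s) (b j) ≤ D) → (∃ j, i ≤ j ∧ j ≤ n ∧ dist (γ t) (b j) ≤ D) →
      gromovProduct (b i) (b 0) (b n) ≤ L * (L * (2 * D + 1) + L) + L + D := by
    rintro s t hs ht hst ⟨j, hj, hj'⟩ ⟨k, hk, hkn, hk'⟩
    have h1 : dist (b j) (b k) ≤ 2 * D + 1 := by
      have h1 := dist_triangle_left (b j) (b k) (γ s)
      have h2 := dist_triangle (γ s) (γ t) (b k)
      linarith
    have h2 : (k : ℝ) - j ≤ L * (2 * D + 1) + L := by
      have := mul_le_mul_of_nonneg_left h1 hL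
      linarith [(hb j k (by omega) hkn).2]
    have h3 : dist (b j) (b i) ≤ L * (L * (2 * D + 1) + L) + L := by
      have h3 : (i : ℝ) ≤ k := by exact_mod_cast hk
      have := mul_le_mul_of_nonneg_left (show (i : ℝ) - j ≤ L * (2 * D + 1) + L by linarith) hL
      linarith [(hb j i hj hi).1]
    have h4 : dist (b i) (γ s) ≤ L * (L * (2 * D + 1) + L) + L + D := by
      linarith [dist_triangle_left (b i) (γ s) (b j), dist_comm (b j) (γ s)]
    refine le_trans (gromovProduct_le_dist_of_dist_add_le (p := γ s) _ ?_) h4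
    rw [← h0, ← hm, hγ 0 s (Nat.zero_le _) hs, hγ s m hs le_rfl, hγ 0 m (Nat.zero_le _) le_rfl]
    simp
  have hcover : ∀ t ≤ m, (∃ j ≤ i, dist (γ t) (b j) ≤ D) ∨
      ∃ j, i ≤ j ∧ j ≤ n ∧ dist (γ t) (b j) ≤ D := by
    intro t ht
    obtain ⟨j, hj, hj'⟩ := hnear t ht
    rcases le_total j i with h | h
    · exact Or.inl ⟨j, h, hj'⟩
    · exact Or.inr ⟨j, h, hj, hj'⟩
  rcases exists_switch hcover ⟨0, Nat.zero_le _, by simpa [h0] using hD0⟩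
    ⟨n, hi, le_rfl, by simpa [hm] using hD0⟩ with ⟨t, ht, hP, hQ⟩ | ⟨t, ht, hP, hQ⟩
  · exact key t t ht ht (by simp) hP hQ
  · refine key t (t + 1) ht.le ht ?_ hP hQ
    rw [hγ t (t + 1) (by omega) ht]
    push_cast
    linarith

/-- A point with a small Gromov product of the ends of a quasi-geodesic is close to it. -/
theorem HyperbolicWith.exists_dist_quasiGeodesic_le {δ : ℝ} (hS : HyperbolicWith δ S)
    {L K K' : ℝ} (hL : 0 ≤ L) {n : ℕ} {b : ℕ → S} (hb : IsQuasiGeodesic L n b)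
    (hK : ∀ i ≤ n, gromovProduct (b i) (b 0) (b n) ≤ K) {p : S}
    (hp : gromovProduct p (b 0) (b n) ≤ K') :
    ∃ i ≤ n, dist p (b i) ≤ K + 2 * (K' + δ + 2 * L) := by
  have hδ := hS.nonneg p
  -- The sum of the two products at `p` is at least `dist p (b i)` minus the product of `b 0` and `b
  -- n` at `b i`, which is at most `K`.
  have key : ∀ i ≤ n, gromovProduct p (b 0) (b i) ≤ K' + δ + 2 * L →
      gromovProduct p (b i) (b n) ≤ K' + δ + 2 * L →
      ∃ i ≤ n, dist p (b i) ≤ K + 2 * (K' + δ + 2 * L) := by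
    intro i hi h1 h2
    refine ⟨i, hi, ?_⟩
    have h3 := hK i hi
    have h4 := dist_triangle_right (b 0) (b n) p
    unfold gromovProduct at h1 h2 h3
    rw [dist_comm (b i) p] at h1 h2
    rw [dist_comm (b n) (b i)] at h3
    linarith
  have hcover : ∀ i ≤ n, gromovProduct p (b i) (b n) ≤ K' + δ ∨
      gromovProduct p (b 0) (b i) ≤ K' + δ := by
    intro i _
    by_contra! h
    have h1 := hS (b 0) (b i) (b n) p
    have h2 := lt_min h.2 h.1
    linarith
  have hp' : gromovProduct p (b 0) (b n) ≤ K' + δ := by linarith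
  rcases exists_switch hcover hp' hp' with ⟨i, hi, h1, h2⟩ | ⟨i, hi, h1, h2⟩
  · exact key i hi (by linarith) (by linarith)
  · refine key i hi.le ?_ (by linarith)
    have h3 := gromovProduct_le_add_dist p (b 0) (b i) (b (i + 1))
    have h4 := (hb i (i + 1) (by omega) hi).1
    push_cast at h4
    linarith

/-! ### Slim triangles and transfer of hyperbolicity. -/

/-- A space with slim discrete geodesic triangles is hyperbolic. -/
theorem isGromovHyperbolic_of_slim {K : ℝ} (n : S → S → ℕ) (p : S → S → ℕ → S)
    (h0 : ∀ x y, p x y 0 = x) (hn : ∀ x y, p x y (n x y) = y)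
    (hp : ∀ x y, ∀ i j : ℕ, i ≤ j → j ≤ n x y → dist (p x y i) (p x y j) = j - i)
    (hslim : ∀ x y z, ∀ i ≤ n x z, (∃ j ≤ n x y, dist (p x z i) (p x y j) ≤ K) ∨
      ∃ j ≤ n y z, dist (p x z i) (p y z j) ≤ K) : IsGromovHyperbolic S := by
  have hadd : ∀ x y, ∀ i ≤ n x y, dist x (p x y i) + dist (p x y i) y = dist x y := by
    intro x y i hi
    have h1 := hp x y 0 i (Nat.zero_le _) hi
    have h2 := hp x y i _ hi le_rfl
    have h3 := hp x y 0 _ (Nat.zero_le _) le_rfl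
    rw [h0] at h1 h3
    rw [hn] at h2 h3
    rw [h1, h2, h3]
    simp
  have hprod : ∀ x y o, ∀ i ≤ n x y, gromovProduct o x y ≤ dist o (p x y i) := fun x y o i hi =>
    gromovProduct_le_dist_of_dist_add_le o (hadd x y i hi).le
  have hK0 : ∀ _ : S, 0 ≤ K := fun x => by
    rcases hslim x x x 0 (Nat.zero_le _) with ⟨j, -, hj⟩ | ⟨j, -, hj⟩ <;>
      exact dist_nonneg.trans hj
  -- Converse to `hprod`: where the side from `x` to `y` switches from following `[x, o]` to
  -- following `[o, y]`, its distance to `o` is the Gromov product up to a constant.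
  have hlow : ∀ x y o, ∃ i ≤ n x y, dist o (p x y i) ≤ gromovProduct o x y + 2 * K + 1 := by
    intro x y o
    have hK0' := hK0 o
    have key : ∀ s t, s ≤ n x y → t ≤ n x y → dist (p x y s) (p x y t) ≤ 1 →
        (∃ j ≤ n x o, dist (p x y s) (p x o j) ≤ K) →
        (∃ j ≤ n o y, dist (p x y t) (p o y j) ≤ K) →
        ∃ i ≤ n x y, dist o (p x y i) ≤ gromovProduct o x y + 2 * K + 1 := by
      rintro s t hs ht hst ⟨j, hj, hj'⟩ ⟨k, hk, hk'⟩
      refine ⟨s, hs, ?_⟩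
      have h1 := hadd x o j hj
      have h2 := hadd o y k hk
      have h3 := hadd x y s hs
      have h4 := dist_triangle (p x y s) (p x o j) o
      have h5 := dist_triangle_right x (p x y s) (p x o j)
      have h6 := dist_triangle (p x y s) (p x y t) (p o y k)
      have h7 := dist_triangle_right o (p x y s) (p o y k)
      have h8 := dist_triangle (p x y s) (p o y k) y
      unfold gromovProduct
      rw [dist_comm y o]
      rw [dist_comm (p x y s) o] at h4
      linarith
    rcases exists_switch (P := fun t => ∃ j ≤ n x o, dist (p x y t) (p x o j) ≤ K)
      (Q := fun t => ∃ j ≤ n o y, dist (p x y t) (p o y j) ≤ K) (m := n x y) (hslim x o y)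
      ⟨0, Nat.zero_le _, by simpa [h0] using hK0'⟩
      ⟨n o y, le_rfl, by simpa [hn] using hK0'⟩ with ⟨t, ht, hP, hQ⟩ | ⟨t, ht, hP, hQ⟩
    · exact key t t ht ht (by simp) hP hQ
    · refine key t (t + 1) ht.le ht ?_ hP hQ
      rw [hp x y t (t + 1) (by omega) ht]
      push_cast
      linarith
  refine ⟨3 * K + 1, fun x y z o => ?_⟩
  obtain ⟨i, hi, hi'⟩ := hlow x z o
  rcases hslim x y z i hi with ⟨j, hj, hj'⟩ | ⟨j, hj, hj'⟩
  · have h1 := hprod x y o j hj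
    have h2 := dist_triangle o (p x z i) (p x y j)
    have h3 := min_le_left (gromovProduct o x y) (gromovProduct o y z)
    linarith
  · have h1 := hprod y z o j hj
    have h2 := dist_triangle o (p x z i) (p y z j)
    have h3 := min_le_right (gromovProduct o x y) (gromovProduct o y z)
    linarith

/-- Hyperbolicity is inherited along quasi-isometric embeddings. -/
theorem IsGromovHyperbolic.of_isQIEmbeddingWith (hT : IsGromovHyperbolic T)
    (hgS : HasDiscreteGeodesics S) (hgT : HasDiscreteGeodesics T) {L : ℝ} (hL : 0 ≤ L)
    {f : S → T} (hf : IsQIEmbeddingWith L f) : IsGromovHyperbolic S := by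
  obtain ⟨δ, hδ⟩ := hT
  replace hδ : HyperbolicWith δ T := hδ
  obtain ⟨K, hK⟩ := hδ.exists_gromovProduct_quasiGeodesic_le hgT hL
  choose n p h0 hn hp using hgS
  have hb : ∀ x y, IsQuasiGeodesic L (n x y) (fun i => f (p x y i)) := by
    intro x y i j hij hj
    have := hf (p x y i) (p x y j)
    rwa [hp x y i j hij hj] at this
  have hnear : ∀ x y q, gromovProduct (f q) (f x) (f y) ≤ K + δ → ∃ i ≤ n x y,
      dist q (p x y i) ≤ L * (K + 2 * (K + δ + δ + 2 * L)) + L := by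
    intro x y q hq
    obtain ⟨i, hi, hi'⟩ := hδ.exists_dist_quasiGeodesic_le hL (hb x y) (hK _ _ (hb x y))
      (p := f q) (K' := K + δ) (by simpa only [h0, hn] using hq)
    refine ⟨i, hi, ((hf _ _).2).trans ?_⟩
    have := mul_le_mul_of_nonneg_left hi' hL
    linarith
  refine isGromovHyperbolic_of_slim n p h0 hn hp
    (K := L * (K + 2 * (K + δ + δ + 2 * L)) + L) fun x y z i hi => ?_
  have h1 := hK _ _ (hb x z) i hi
  simp only [h0, hn] at h1
  -- Seen from the image of a point of `[x, z]`, the product of `f x` and `f z` is at most `K`, so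
  -- the product for one of the other two sides is at most `K + δ`, and `hnear` applies to that
  -- side.
  have h2 := hδ (f x) (f y) (f z) (f (p x z i))
  rcases le_or_gt (gromovProduct (f (p x z i)) (f x) (f y)) (K + δ) with h3 | h3
  · exact Or.inl (hnear x y _ h3)
  · refine Or.inr (hnear y z _ ?_)
    by_contra! h4
    have := lt_min h3 h4
    linarith

end Coarse

/-! ### Acylindricity -/

section Acylindrical

/-- Acylindricity is inherited along equivariant quasi-isometric embeddings. -/
theorem IsAcylindrical.of_isQIEmbeddingWith {Γ Λ S T : Type*} [Group Γ] [Group Λ] [MetricSpace S]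
    [MetricSpace T] [MulAction Γ S] [MulAction Λ T] (h : IsAcylindrical Λ T) {L : ℝ} (hL : 0 < L)
    {f : S → T} (hf : IsQIEmbeddingWith L f) {φ : Γ → Λ} (hφ : Function.Injective φ)
    (hequiv : ∀ g x, f (g • x) = φ g • f x) : IsAcylindrical Γ S := by
  intro ε hε
  obtain ⟨R, N, hR, hN⟩ := h (L * ε + L) (by positivity)
  refine ⟨L * R + L, N, by positivity, fun x y hxy => ?_⟩
  have h1 : R ≤ dist (f x) (f y) := by
    have := hxy.trans (hf x y).2
    exact le_of_mul_le_mul_left (by linarith) hL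
  refine le_trans ?_ (hN _ _ h1)
  rw [← hφ.encard_image]
  refine Set.encard_le_encard ?_
  rintro _ ⟨g, ⟨hx, hy⟩, rfl⟩
  constructor
  · rw [← hequiv]
    exact ((hf _ _).1).trans (by gcongr)
  · rw [← hequiv]
    exact ((hf _ _).1).trans (by gcongr)

/-- An isometric action is acylindrical if its restriction to a subgroup of finite index is. -/
theorem IsAcylindrical.of_finiteIndex {Γ S : Type*} [Group Γ] [MetricSpace S] [MulAction Γ S]
    [IsIsometricSMul Γ S] (H : Subgroup Γ) [H.FiniteIndex] (h : IsAcylindrical H S) :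
    IsAcylindrical Γ S := by
  intro ε hε
  obtain ⟨R, N, hR, hN⟩ := h (2 * ε) (by positivity)
  refine ⟨R, Nat.card (Γ ⧸ H) * N, hR, fun x y hxy => ?_⟩
  have : Fintype (Γ ⧸ H) := Fintype.ofFinite _
  set M := {g : Γ | dist x (g • x) ≤ ε ∧ dist y (g • y) ≤ ε} with hM
  -- For a fixed `a` in the coset lying in `M`, each `a⁻¹ * g` is in `H` and moves `x` and `y` by at
  -- most `2 * ε`.
  have hcoset : ∀ q : Γ ⧸ H, {g ∈ M | (g : Γ ⧸ H) = q}.encard ≤ N := by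
    intro q
    rcases Set.eq_empty_or_nonempty {g ∈ M | (g : Γ ⧸ H) = q} with h0 | ⟨a, ha, rfl⟩
    · rw [h0]
      simp
    refine le_trans ?_ (hN x y hxy)
    rw [← (Function.Injective.encard_image
      (f := fun b : H => a * (b : Γ)) (fun b c hbc => Subtype.ext (mul_left_cancel hbc)))]
    refine Set.encard_le_encard ?_
    rintro g ⟨hg, hga⟩
    refine ⟨⟨a⁻¹ * g, QuotientGroup.eq.1 hga.symm⟩, ?_, by simp⟩
    have key : ∀ z : S, dist z (a • z) ≤ ε → dist z (g • z) ≤ ε →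
        dist z ((a⁻¹ * g) • z) ≤ 2 * ε := by
      intro z h1 h2
      rw [← dist_smul a z, ← mul_smul, mul_inv_cancel_left]
      linarith [dist_triangle_left (a • z) (g • z) z]
    exact ⟨key x ha.1 hg.1, key y ha.2 hg.2⟩
  have hunion : M ⊆ ⋃ q ∈ (Finset.univ : Finset (Γ ⧸ H)), {g ∈ M | (g : Γ ⧸ H) = q} := by
    intro g hg
    simpa using hg
  calc M.encard ≤ (⋃ q ∈ (Finset.univ : Finset (Γ ⧸ H)), {g ∈ M | (g : Γ ⧸ H) = q}).encard :=
        Set.encard_le_encard hunion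
    _ ≤ ∑ q : Γ ⧸ H, {g ∈ M | (g : Γ ⧸ H) = q}.encard := Finset.set_encard_biUnion_le _ _
    _ ≤ ∑ _q : Γ ⧸ H, (N : ℕ∞) := Finset.sum_le_sum fun q _ => hcoset q
    _ = ((Nat.card (Γ ⧸ H) * N : ℕ) : ℕ∞) := by
      simp [Nat.card_eq_fintype_card]

end Acylindrical

/-! ### Word metrics -/

section WordMetric

variable {G : Type u} [Group G]

instance (X : GenSet G) : IsIsometricSMul G (Cayley X) where
  isometry_smul g := Isometry.of_dist_eq fun x y => by
    have key : ∀ (g : G) (x y : Cayley X), dist (g • x) (g • y) ≤ dist x y := by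
      intro g x y
      obtain ⟨w, hw⟩ := (mulCayley_connected X.closure_eq_top).exists_walk_length_eq_dist
        x.elem y.elem
      rw [Cayley.dist_def, Cayley.dist_def, ← hw]
      let F : SimpleGraph.mulCayley X.carrier →g SimpleGraph.mulCayley X.carrier :=
        ⟨fun a => g * a, fun h => SimpleGraph.mulCayley_adj_mul_iff_right.2 h⟩
      have := SimpleGraph.dist_le (w.map F)
      rw [SimpleGraph.Walk.length_map] at this
      exact_mod_cast this
    refine le_antisymm (key g x y) ?_
    simpa using key g⁻¹ (g • x) (g • y)

theorem Cayley.hasDiscreteGeodesics (X : GenSet G) : HasDiscreteGeodesics (Cayley X) := by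
  intro x y
  have hconn := mulCayley_connected X.closure_eq_top
  obtain ⟨w, hw⟩ := hconn.exists_walk_length_eq_dist x.elem y.elem
  have hle : ∀ i j : ℕ, i ≤ j → j ≤ w.length →
      dist (⟨w.getVert i⟩ : Cayley X) ⟨w.getVert j⟩ ≤ j - i := by
    intro i j hij
    induction j, hij using Nat.le_induction with
    | base => simp
    | succ j hij ih =>
      intro hj
      have h1 := ih (by omega)
      have h2 := dist_triangle (⟨w.getVert i⟩ : Cayley X) ⟨w.getVert j⟩ ⟨w.getVert (j + 1)⟩
      have h3 : dist (⟨w.getVert j⟩ : Cayley X) ⟨w.getVert (j + 1)⟩ = 1 := by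
        rw [Cayley.dist_def]
        exact_mod_cast SimpleGraph.dist_eq_one_iff_adj.2 (w.adj_getVert_succ hj)
      push_cast
      linarith
  refine ⟨w.length, fun i => ⟨w.getVert i⟩, ?_, ?_, fun i j hij hj => ?_⟩
  · exact Cayley.ext (by simp)
  · exact Cayley.ext (by simp)
  -- A shorter connection from `i` to `j` would shorten the whole minimal walk.
  refine le_antisymm (hle i j hij hj) ?_
  have h1 := hle 0 i (Nat.zero_le _) (by omega)
  have h2 := hle j _ hj le_rfl
  have h3 : dist (⟨w.getVert 0⟩ : Cayley X) ⟨w.getVert w.length⟩ = w.length := by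
    rw [w.getVert_zero, w.getVert_length, Cayley.dist_def, hw]
  have h4 := dist_triangle4 (⟨w.getVert 0⟩ : Cayley X) ⟨w.getVert i⟩ ⟨w.getVert j⟩
    ⟨w.getVert w.length⟩
  push_cast at h1
  linarith

theorem Cayley.dist_mul_le_one (X : GenSet G) {x : G} (hx : x ∈ X.carrier) (g : G) :
    dist (⟨g⟩ : Cayley X) ⟨g * x⟩ ≤ 1 := by
  by_cases h : g = g * x
  · rw [← h]
    simp
  · rw [Cayley.dist_def]
    exact_mod_cast (SimpleGraph.dist_eq_one_iff_adj.2
      ((SimpleGraph.mulCayley_adj' X.carrier g (g * x)).2 ⟨h, x, hx, Or.inl rfl⟩)).le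

/-- A map out of a Cayley graph is Lipschitz if it moves the ends of edges by a bounded amount. -/
theorem Cayley.dist_map_le (X : GenSet G) {T : Type v} [PseudoMetricSpace T] (f : G → T) {C : ℝ}
    (hf : ∀ g, ∀ x ∈ X.carrier, dist (f g) (f (g * x)) ≤ C) (a b : Cayley X) :
    dist (f a.elem) (f b.elem) ≤ C * dist a b := by
  obtain ⟨w, hw⟩ := (mulCayley_connected X.closure_eq_top).exists_walk_length_eq_dist a.elem b.elem
  rw [Cayley.dist_def, ← hw]
  clear hw
  generalize a.elem = a at w
  generalize b.elem = b at w
  induction w with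
  | nil => simp
  | @cons u v w h p ih =>
    have h1 : dist (f u) (f v) ≤ C := by
      obtain ⟨-, x, hx, rfl | rfl⟩ := (SimpleGraph.mulCayley_adj' _ _ _).1 h
      · exact hf _ x hx
      · rw [dist_comm]
        exact hf _ x hx
    have h2 := dist_triangle (f u) (f v) (f w)
    rw [SimpleGraph.Walk.length_cons]
    push_cast
    linarith

/-- The word length of `g` with respect to `X`. -/
noncomputable def wordLength (X : GenSet G) (g : G) : ℝ :=
  dist (⟨1⟩ : Cayley X) ⟨g⟩

theorem wordLength_nonneg (X : GenSet G) (g : G) : 0 ≤ wordLength X g := dist_nonneg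

theorem Cayley.dist_eq_wordLength (X : GenSet G) (a b : Cayley X) :
    dist a b = wordLength X (a.elem⁻¹ * b.elem) := by
  rw [wordLength, ← dist_smul a.elem (⟨1⟩ : Cayley X), Cayley.smul_def, Cayley.smul_def]
  simp

theorem wordLength_le_one (X : GenSet G) {x : G} (hx : x ∈ X.carrier) : wordLength X x ≤ 1 := by
  simpa [wordLength] using Cayley.dist_mul_le_one X hx 1

theorem wordLength_inv (X : GenSet G) (g : G) : wordLength X g⁻¹ = wordLength X g := by
  have := dist_comm (⟨1⟩ : Cayley X) ⟨g⟩
  rw [Cayley.dist_eq_wordLength, Cayley.dist_eq_wordLength] at this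
  simpa using this.symm

theorem wordLength_mul_le (X : GenSet G) (g h : G) :
    wordLength X (g * h) ≤ wordLength X g + wordLength X h := by
  have := dist_triangle (⟨1⟩ : Cayley X) ⟨g⟩ ⟨g * h⟩
  rw [Cayley.dist_eq_wordLength X ⟨g⟩] at this
  simpa [wordLength] using this

/-- A homomorphism which is bounded on generators is Lipschitz. -/
theorem wordLength_map_le {G' : Type v} [Group G'] (X : GenSet G) (Y : GenSet G') (φ : G →* G')
    {C : ℝ} (hC : ∀ x ∈ X.carrier, wordLength Y (φ x) ≤ C) (g : G) :
    wordLength Y (φ g) ≤ C * wordLength X g := by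
  have := Cayley.dist_map_le X (fun g => (⟨φ g⟩ : Cayley Y)) (C := C) (fun g x hx => by
    rw [Cayley.dist_eq_wordLength]
    simpa using hC x hx) ⟨1⟩ ⟨g⟩
  simpa [wordLength] using this

/-- Left-invariance reduces the Lipschitz condition to edges at the identity, that is, to
generators. -/
theorem GenSet.le_iff {X Y : GenSet G} :
    X ≤ Y ↔ ∃ C : ℝ, ∀ y ∈ Y.carrier, wordLength X y ≤ C := by
  constructor
  · rintro ⟨C, hC⟩
    refine ⟨C, fun y hy => (hC.dist_le_mul ⟨1⟩ ⟨y⟩).trans ?_⟩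
    exact mul_le_of_le_one_right C.2 (wordLength_le_one Y hy)
  · rintro ⟨C, hC⟩
    refine ⟨C.toNNReal, LipschitzWith.of_dist_le_mul fun a b => ?_⟩
    refine (Cayley.dist_map_le Y (fun g => (⟨g⟩ : Cayley X)) (C := C) (fun g x hx => ?_) a b).trans
      (mul_le_mul_of_nonneg_right (Real.le_coe_toNNReal C) dist_nonneg)
    rw [Cayley.dist_eq_wordLength]
    simpa using hC x hx

theorem GenSet.toClass_le_iff {X Y : GenSet G} : X.toClass ≤ Y.toClass ↔ X ≤ Y :=
  toAntisymmetrization_le_toAntisymmetrization_iff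

theorem GenSet.exists_wordLength_le {X Y : GenSet G} (h : X ≤ Y) :
    ∃ C : ℝ, 0 ≤ C ∧ ∀ g, wordLength X g ≤ C * wordLength Y g := by
  obtain ⟨C, hC⟩ := GenSet.le_iff.1 h
  refine ⟨max C 0, le_max_right _ _, fun g => ?_⟩
  exact wordLength_map_le Y X (MonoidHom.id G) (fun x hx => (hC x hx).trans (le_max_left _ _)) g

/-- Membership in `AH G` provides only some representative; equivalent word metrics are
quasi-isometric by the identity, so both properties pass to every representative. -/
theorem toClass_mem_AH_iff {X : GenSet G} :
    X.toClass ∈ AH G ↔ IsGromovHyperbolic (Cayley X) ∧ IsAcylindrical G (Cayley X) := by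
  refine ⟨?_, fun h => ⟨X, h.1, h.2, rfl⟩⟩
  rintro ⟨X', hhyp, hacyl, heq⟩
  obtain ⟨C, hC0, hC⟩ := GenSet.exists_wordLength_le (GenSet.toClass_le_iff.1 heq.le)
  obtain ⟨D, hD0, hD⟩ := GenSet.exists_wordLength_le (GenSet.toClass_le_iff.1 heq.ge)
  have hL : 0 < C + D + 1 := by linarith
  have hf : IsQIEmbeddingWith (C + D + 1) (fun g : Cayley X => (⟨g.elem⟩ : Cayley X')) := by
    intro x y
    rw [Cayley.dist_eq_wordLength, Cayley.dist_eq_wordLength]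
    have h1 := hC (x.elem⁻¹ * y.elem)
    have h2 := hD (x.elem⁻¹ * y.elem)
    have h3 := wordLength_nonneg X (x.elem⁻¹ * y.elem)
    have h4 := wordLength_nonneg X' (x.elem⁻¹ * y.elem)
    constructor <;> nlinarith
  exact ⟨hhyp.of_isQIEmbeddingWith (Cayley.hasDiscreteGeodesics X)
      (Cayley.hasDiscreteGeodesics X') hL.le hf,
    hacyl.of_isQIEmbeddingWith hL hf (φ := id) Function.injective_id fun g x => rfl⟩

/-- The image of a generating set under an automorphism. -/
def GenSet.map (φ : G ≃* G) (X : GenSet G) : GenSet G where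
  carrier := φ '' X.carrier
  closure_eq_top := by
    have := MonoidHom.map_closure (φ : G →* G) X.carrier
    rw [X.closure_eq_top, Subgroup.map_top_of_surjective _ φ.surjective] at this
    exact this.symm

theorem wordLength_map (φ : G ≃* G) (X : GenSet G) (g : G) :
    wordLength (X.map φ) (φ g) = wordLength X g := by
  refine le_antisymm ?_ ?_
  · simpa using wordLength_map_le X (X.map φ) (φ : G →* G) (C := 1)
      (fun x hx => wordLength_le_one _ ⟨x, hx, rfl⟩) g
  · have := wordLength_map_le (X.map φ) X (φ.symm : G →* G) (C := 1) (by
      rintro _ ⟨x, hx, rfl⟩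
      simpa using wordLength_le_one X hx) (φ g)
    simpa using this

/-- The automorphism group preserves the set of acylindrically hyperbolic structures. -/
theorem toClass_map_mem_AH (φ : G ≃* G) {X : GenSet G} (hX : X.toClass ∈ AH G) :
    (X.map φ).toClass ∈ AH G := by
  rw [toClass_mem_AH_iff] at hX ⊢
  have hf : IsQIEmbeddingWith 1
      (fun g : Cayley (X.map φ) => (⟨φ.symm g.elem⟩ : Cayley X)) := by
    intro x y
    have : dist (⟨φ.symm x.elem⟩ : Cayley X) ⟨φ.symm y.elem⟩ = dist x y := by
      rw [Cayley.dist_eq_wordLength, Cayley.dist_eq_wordLength, ← wordLength_map φ]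
      simp
    rw [this]
    constructor <;> linarith
  exact ⟨hX.1.of_isQIEmbeddingWith (Cayley.hasDiscreteGeodesics _)
      (Cayley.hasDiscreteGeodesics _) zero_le_one hf,
    hX.2.of_isQIEmbeddingWith one_pos hf (φ := φ.symm) φ.symm.injective
      fun g x => Cayley.ext (map_mul φ.symm g x.elem)⟩

end WordMetric

/-! ### Finite index normal subgroups -/

section FiniteIndex

variable {G : Type u} [Group G] {H : Subgroup G} {Y : Set G}

/-! ### Coset representatives and the retraction. -/

/-- The element of the transversal `Y` in the coset of `g`. -/
noncomputable def cosetRep (hY : Subgroup.IsComplement Y (H : Set G)) (g : G) : G :=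
  (hY.equiv g).1

theorem cosetRep_mem (hY : Subgroup.IsComplement Y (H : Set G)) (g : G) : cosetRep hY g ∈ Y :=
  (hY.equiv g).1.2

theorem cosetRep_mul_right (hY : Subgroup.IsComplement Y (H : Set G)) (g : G) {h : G}
    (hh : h ∈ H) : cosetRep hY (g * h) = cosetRep hY g := by
  unfold cosetRep
  rw [hY.equiv_mul_right_of_mem hh]

theorem inv_cosetRep_mul_mem (hY : Subgroup.IsComplement Y (H : Set G)) (g : G) :
    (cosetRep hY g)⁻¹ * g ∈ H := by
  have h := hY.equiv_fst_mul_equiv_snd g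
  have h2 : (cosetRep hY g)⁻¹ * g = (hY.equiv g).2 := by
    rw [inv_mul_eq_iff_eq_mul]
    exact h.symm
  rw [h2]
  exact (hY.equiv g).2.2

/-- Normality turns `g = y * h` into `g = h' * y`; putting the factor from `H` on the left makes the
retraction equivariant for left translation by `H`. -/
theorem mul_inv_cosetRep_mem [H.Normal] (hY : Subgroup.IsComplement Y (H : Set G)) (g : G) :
    g * (cosetRep hY g)⁻¹ ∈ H :=
  Subgroup.Normal.mem_comm ‹_› (inv_cosetRep_mul_mem hY g)

theorem cosetRep_mul_left [H.Normal] (hY : Subgroup.IsComplement Y (H : Set G)) (g : G) {h : G}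
    (hh : h ∈ H) : cosetRep hY (h * g) = cosetRep hY g := by
  have : h * g = g * (g⁻¹ * h * g) := by group
  rw [this]
  refine cosetRep_mul_right hY g ?_
  simpa using Subgroup.Normal.conj_mem ‹_› h hh g⁻¹

/-- The retraction of `G` to `H` along a transversal. -/
noncomputable def retract [H.Normal] (hY : Subgroup.IsComplement Y (H : Set G)) (g : G) : H :=
  ⟨g * (cosetRep hY g)⁻¹, mul_inv_cosetRep_mem hY g⟩

theorem retract_mul_left [H.Normal] (hY : Subgroup.IsComplement Y (H : Set G)) (h : H) (g : G) :
    retract hY (h * g) = h * retract hY g := by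
  apply Subtype.ext
  simp only [retract, Subgroup.coe_mul]
  rw [cosetRep_mul_left hY g h.2, mul_assoc]

theorem exists_wordLength_le_of_finite (X : GenSet G) {F : Set G} (hF : F.Finite) :
    ∃ C : ℝ, 0 ≤ C ∧ ∀ g ∈ F, wordLength X g ≤ C := by
  obtain ⟨C, hC⟩ := (hF.image (wordLength X)).bddAbove
  exact ⟨max C 0, le_max_right _ _, fun g hg => (hC ⟨g, hg, rfl⟩).trans (le_max_left _ _)⟩

theorem closure_union_transversal_eq_top (X : GenSet H)
    (hY : Subgroup.IsComplement Y (H : Set G)) :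
    Subgroup.closure (((↑) : H → G) '' X.carrier ∪ Y) = ⊤ := by
  rw [Subgroup.closure_union, eq_top_iff]
  intro g _
  have hH : Subgroup.closure (((↑) : H → G) '' X.carrier) = H := by
    have := MonoidHom.map_closure H.subtype X.carrier
    rw [X.closure_eq_top, ← MonoidHom.range_eq_map, Subgroup.range_subtype] at this
    exact this.symm
  rw [hH, ← mul_inv_cancel_left (cosetRep hY g) g]
  exact mul_mem (Subgroup.mem_sup_right (Subgroup.subset_closure (cosetRep_mem hY g)))
    (Subgroup.mem_sup_left (inv_cosetRep_mul_mem hY g))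

/-- The generating set `X ∪ Y` of `G`. -/
def unionTransversal (X : GenSet H) (hY : Subgroup.IsComplement Y (H : Set G)) : GenSet G :=
  ⟨((↑) : H → G) '' X.carrier ∪ Y, closure_union_transversal_eq_top X hY⟩

theorem wordLength_coe_le (X : GenSet H) (hY : Subgroup.IsComplement Y (H : Set G)) (h : H) :
    wordLength (unionTransversal X hY) h ≤ wordLength X h := by
  simpa using wordLength_map_le X (unionTransversal X hY) H.subtype (C := 1)
    (fun x hx => wordLength_le_one _ (Or.inl ⟨x, hx, rfl⟩)) h

/-! ### Extending the largest structure from `H` to `G`. -/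

/-- Conjugates of elements of a largest element of `AH H` have bounded length. -/
theorem exists_wordLength_conj_le [H.Normal] {X : GenSet H} (hX : IsGreatest (AH H) X.toClass)
    (g : G) : ∃ C : ℝ, ∀ x ∈ X.carrier, wordLength X (MulAut.conjNormal g x) ≤ C := by
  have h := GenSet.toClass_le_iff.1 (hX.2 (toClass_map_mem_AH (MulAut.conjNormal g)⁻¹ hX.1))
  obtain ⟨C, hC⟩ := GenSet.le_iff.1 h
  refine ⟨C, fun x hx => ?_⟩
  rw [← wordLength_map (MulAut.conjNormal g)⁻¹]
  simpa using hC x hx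

/-- The retraction to `H` is a quasi-isometric embedding of the Cayley graph with respect to
`X ∪ Y`. -/
theorem exists_isQIEmbeddingWith_retract [H.Normal] [H.FiniteIndex] {X : GenSet H}
    (hX : IsGreatest (AH H) X.toClass) (hY : Subgroup.IsComplement Y (H : Set G)) :
    ∃ L : ℝ, 0 < L ∧ IsQIEmbeddingWith L
      (fun g : Cayley (unionTransversal X hY) => (⟨retract hY g.elem⟩ : Cayley X)) := by
  have hYfin : Y.Finite := hY.finite_left
  choose c hc using exists_wordLength_conj_le hX
  obtain ⟨C, hC⟩ := (hYfin.image c).bddAbove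
  have hFfin : ((fun t : G × G × G => t.1 * t.2.1 * t.2.2⁻¹) '' (Y ×ˢ Y ×ˢ Y)).Finite :=
    (hYfin.prod (hYfin.prod hYfin)).image _
  obtain ⟨D, hD0, hD⟩ := exists_wordLength_le_of_finite X
    (hFfin.preimage (f := ((↑) : H → G)) Subtype.val_injective.injOn)
  refine ⟨max C D + 2, by positivity, fun a b => ⟨?_, ?_⟩⟩
  -- With `y`, `y'` the representatives of `g` and `g * z`, an edge labelled `z` moves the
  -- retraction by `y * z * y'⁻¹`. For `z` in `X` one has `y' = y`, a conjugate bounded by `C`; for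
  -- `z` in `Y` it lies in a finite set, bounded by `D`.
  · have hlip := Cayley.dist_map_le (unionTransversal X hY)
      (fun g => (⟨retract hY g⟩ : Cayley X)) (C := max C D) (fun g z hz => by
        rw [Cayley.dist_eq_wordLength]
        rcases hz with ⟨x, hx, rfl⟩ | hz
        · refine le_trans (le_of_eq ?_) ((hc (cosetRep hY g) x hx).trans
            ((hC ⟨_, cosetRep_mem hY g, rfl⟩).trans (le_max_left C D)))
          congr 1
          apply Subtype.ext
          simp only [retract, cosetRep_mul_right hY g x.2, Subgroup.coe_mul, Subgroup.coe_inv,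
            MulAut.conjNormal_apply]
          group
        · refine (hD _ ⟨(cosetRep hY g, z, cosetRep hY (g * z)),
            ⟨cosetRep_mem hY _, hz, cosetRep_mem hY _⟩, ?_⟩).trans (le_max_right C D)
          simp only [retract, Subgroup.coe_mul, Subgroup.coe_inv]
          group) a b
    have := dist_nonneg (x := a) (y := b)
    have := le_max_right C D
    linarith
  -- Undoing the retraction costs one letter of `Y` at each end, hence the `2` in the constant.
  · have hmove : ∀ g, wordLength (unionTransversal X hY) (cosetRep hY g) ≤ 1 := fun g =>
      wordLength_le_one _ (Or.inr (cosetRep_mem hY g))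
    have h1 : a.elem⁻¹ * b.elem = (cosetRep hY a.elem)⁻¹ *
        (((retract hY a.elem)⁻¹ * retract hY b.elem : H) : G) * cosetRep hY b.elem := by
      simp only [retract, Subgroup.coe_mul, Subgroup.coe_inv]
      group
    have h2 := wordLength_coe_le X hY ((retract hY a.elem)⁻¹ * retract hY b.elem)
    have h3 := wordLength_nonneg X ((retract hY a.elem)⁻¹ * retract hY b.elem)
    have h4 := hmove a.elem
    have h5 := hmove b.elem
    rw [Cayley.dist_eq_wordLength, Cayley.dist_eq_wordLength, h1]
    refine (wordLength_mul_le _ _ _).trans ?_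
    refine (add_le_add_left (wordLength_mul_le _ _ _) _).trans ?_
    rw [wordLength_inv]
    have h6 : 0 ≤ max C D := hD0.trans (le_max_right C D)
    nlinarith

theorem unionTransversal_mem_AH [H.Normal] [H.FiniteIndex] {X : GenSet H}
    (hX : IsGreatest (AH H) X.toClass) (hY : Subgroup.IsComplement Y (H : Set G)) :
    (unionTransversal X hY).toClass ∈ AH G := by
  obtain ⟨L, hL, hf⟩ := exists_isQIEmbeddingWith_retract hX hY
  obtain ⟨hhyp, hacyl⟩ := toClass_mem_AH_iff.1 hX.1
  refine toClass_mem_AH_iff.2 ⟨hhyp.of_isQIEmbeddingWith (Cayley.hasDiscreteGeodesics _)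
    (Cayley.hasDiscreteGeodesics _) hL.le hf, IsAcylindrical.of_finiteIndex H ?_⟩
  -- The retraction is equivariant for `H` only, which is why acylindricity was first reduced to
  -- `H`.
  exact hacyl.of_isQIEmbeddingWith hL hf (φ := id) Function.injective_id
    fun h g => Cayley.ext (retract_mul_left hY h g.elem)

/-! ### Restricting structures from `G` to `H`. -/

/-- A structure in `AH G` restricts to a structure in `AH H`. -/
theorem exists_mem_AH_restrict [H.Normal] [H.FiniteIndex]
    (hY : Subgroup.IsComplement Y (H : Set G)) {W : GenSet G} (hW : W.toClass ∈ AH G) :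
    ∃ W' : GenSet H, W'.toClass ∈ AH H ∧
      ∃ C : ℝ, 0 ≤ C ∧ ∀ h : H, wordLength W (h : G) ≤ C * wordLength W' h := by
  obtain ⟨D, hD0, hD⟩ := exists_wordLength_le_of_finite W hY.finite_left
  -- An edge labelled `w` moves the retraction by `y * w * y'⁻¹`, of `W`-length at most `D + 1 + D`.
  set V : Set H := {h : H | wordLength W (h : G) ≤ 2 * D + 1} with hV
  have hstep : ∀ g, ∀ w ∈ W.carrier, (retract hY g)⁻¹ * retract hY (g * w) ∈ V := by
    intro g w hw
    have h1 : (((retract hY g)⁻¹ * retract hY (g * w) : H) : G) =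
        cosetRep hY g * w * (cosetRep hY (g * w))⁻¹ := by
      simp only [retract, Subgroup.coe_mul, Subgroup.coe_inv]
      group
    have h2 := wordLength_mul_le W (cosetRep hY g * w) (cosetRep hY (g * w))⁻¹
    have h3 := wordLength_mul_le W (cosetRep hY g) w
    have h4 := hD _ (cosetRep_mem hY g)
    have h5 := hD _ (cosetRep_mem hY (g * w))
    have h6 := wordLength_le_one W hw
    rw [wordLength_inv] at h2
    show wordLength W _ ≤ _
    rw [h1]
    linarith
  -- `Y` need not contain `1`, so `retract hY 1` may be nontrivial; correcting for it on both sides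
  -- gives the `2` in `hlow`.
  have hone : retract hY 1 ∈ V := by
    show wordLength W (1 * (cosetRep hY 1)⁻¹) ≤ _
    rw [one_mul, wordLength_inv]
    linarith [hD _ (cosetRep_mem hY 1)]
  have hret : ∀ h : H, retract hY (h : G) = h * retract hY 1 := by
    intro h
    rw [← retract_mul_left, mul_one]
  -- Following a `W`-word from `1`, the retraction changes by elements of `V` or their inverses; its
  -- value at `h` in `H` is `h * retract hY 1`.
  have hgen : Subgroup.closure V = ⊤ := by
    have hmem : ∀ g : G, retract hY g ∈ Subgroup.closure V := by
      intro g
      have hg : g ∈ Subgroup.closure W.carrier := by rw [W.closure_eq_top]; trivial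
      induction hg using Subgroup.closure_induction_right with
      | one => exact Subgroup.subset_closure hone
      | mul_right x hx y hy ih =>
        rw [← mul_inv_cancel_left (retract hY x) (retract hY (x * y))]
        exact mul_mem ih (Subgroup.subset_closure (hstep x y hy))
      | mul_inv_cancel x hx y hy ih =>
        have h1 := hstep (x * y⁻¹) y hy
        rw [inv_mul_cancel_right] at h1
        have h2 := mul_mem ih (inv_mem (Subgroup.subset_closure h1))
        simpa using h2
    refine eq_top_iff.2 fun h _ => ?_
    have h1 := mul_mem (hmem h) (inv_mem (Subgroup.subset_closure hone))
    rw [hret] at h1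
    simpa using h1
  let W' : GenSet H := ⟨V, hgen⟩
  have hup : ∀ h : H, wordLength W (h : G) ≤ (2 * D + 1) * wordLength W' h := fun h =>
    wordLength_map_le W' W H.subtype (fun x hx => hx) h
  have hlow : ∀ h : H, wordLength W' h ≤ wordLength W (h : G) + 2 := by
    intro h
    have h1 := Cayley.dist_map_le W (fun g => (⟨retract hY g⟩ : Cayley W')) (C := 1)
      (fun g w hw => by
        rw [Cayley.dist_eq_wordLength]
        exact wordLength_le_one W' (hstep g w hw)) ⟨1⟩ ⟨h⟩
    rw [one_mul, Cayley.dist_eq_wordLength, Cayley.dist_eq_wordLength] at h1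
    simp only [hret h, inv_one, one_mul] at h1
    have h2 : h = retract hY 1 * ((retract hY 1)⁻¹ * (h * retract hY 1)) *
        (retract hY 1)⁻¹ := by group
    have h3 := wordLength_le_one W' hone
    have h4 := wordLength_mul_le W' (retract hY 1) ((retract hY 1)⁻¹ * (h * retract hY 1))
    have h5 := wordLength_mul_le W' (retract hY 1 * ((retract hY 1)⁻¹ * (h * retract hY 1)))
      (retract hY 1)⁻¹
    rw [← h2, wordLength_inv] at h5
    linarith
  refine ⟨W', ?_, 2 * D + 1, by linarith, hup⟩
  have hf : IsQIEmbeddingWith (2 * D + 2)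
      (fun h : Cayley W' => (⟨h.elem⟩ : Cayley W)) := by
    intro a b
    rw [Cayley.dist_eq_wordLength, Cayley.dist_eq_wordLength]
    have h1 := hup (a.elem⁻¹ * b.elem)
    have h2 := hlow (a.elem⁻¹ * b.elem)
    have h3 := wordLength_nonneg W' (a.elem⁻¹ * b.elem)
    have h4 := wordLength_nonneg W ((a.elem⁻¹ * b.elem : H) : G)
    simp only [Subgroup.coe_mul, Subgroup.coe_inv] at h1 h2 h4
    constructor <;> nlinarith
  obtain ⟨hhyp, hacyl⟩ := toClass_mem_AH_iff.1 hW
  exact toClass_mem_AH_iff.2 ⟨hhyp.of_isQIEmbeddingWith (Cayley.hasDiscreteGeodesics _)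
    (Cayley.hasDiscreteGeodesics _) (by linarith) hf,
    hacyl.of_isQIEmbeddingWith (by linarith) hf (φ := ((↑) : H → G)) Subtype.val_injective
      fun h x => rfl⟩

theorem isGreatest_unionTransversal [H.Normal] [H.FiniteIndex] {X : GenSet H}
    (hX : IsGreatest (AH H) X.toClass) (hY : Subgroup.IsComplement Y (H : Set G)) :
    IsGreatest (AH G) (unionTransversal X hY).toClass := by
  refine ⟨unionTransversal_mem_AH hX hY, ?_⟩
  rintro a ha
  obtain ⟨W, -, -, rfl⟩ := id ha
  obtain ⟨W', hW', C, hC0, hC⟩ := exists_mem_AH_restrict hY ha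
  obtain ⟨D, hD⟩ := GenSet.le_iff.1 (GenSet.toClass_le_iff.1 (hX.2 hW'))
  obtain ⟨E, -, hE⟩ := exists_wordLength_le_of_finite W hY.finite_left
  refine GenSet.toClass_le_iff.2 (GenSet.le_iff.2 ⟨max (C * D) E, ?_⟩)
  rintro z (⟨x, hx, rfl⟩ | hz)
  · exact ((hC x).trans (mul_le_mul_of_nonneg_left (hD x hx) hC0)).trans (le_max_left _ _)
  · exact (hE z hz).trans (le_max_right _ _)

end FiniteIndex

end AHStruct

theorem mainTheorem1 {G : Type u} [Group G] (H : Subgroup G) (hnormal : H.Normal)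
    (hindex : H.FiniteIndex) (hAH : AHStruct.IsAcylindricallyHyperbolic.{u, v} H)
    (hacc : AHStruct.IsAHAccessible H) :
    AHStruct.IsAHAccessible G ∧
    ∀ (X : AHStruct.GenSet H) (Y : Set G),
      IsGreatest (AHStruct.AH H) X.toClass →
      Subgroup.IsComplement Y (H : Set G) →
      ∃ hgen : Subgroup.closure (((↑) : H → G) '' X.carrier ∪ Y) = ⊤,
        IsGreatest (AHStruct.AH G)
          (AHStruct.GenSet.toClass ⟨((↑) : H → G) '' X.carrier ∪ Y, hgen⟩) := by
  refine ⟨?_, fun X Y hX hY => ⟨AHStruct.closure_union_transversal_eq_top X hY,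
    AHStruct.isGreatest_unionTransversal hX hY⟩⟩
  obtain ⟨a, ha⟩ := hacc
  obtain ⟨X, -, -, rfl⟩ := id ha.1
  obtain ⟨Y, hY, -⟩ := H.exists_isComplement_left 1
  exact ⟨_, AHStruct.isGreatest_unionTransversal ha hY⟩
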